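/- An \emph{exceptional matrix} (of rank $4$) is an upper triangular integer $4\times 4$ matrix with $1$'s on the diagonal, \[ M=\begin{bmatrix}1&a&b&c\\0&1&d&e\\0&0&1&f\\0&0&0&1\end{bmatrix},\qquad a,b,c,d,e,f\in\mathbb{Z}. \] Regard $M$ as the Gram matrix $(\langle e_i,e_j\rangle)_{ij}$ of a basis $(e_1,e_2,e_3,e_4)$ of $\mathbb{Z}^4$ for a bilinear form $\langle-,-\rangle$. For $i=1,2,3$ let $\sigma_i(M)$ be the Gram matrix of the basis obtained by replacing $(e_i,e_{i+1})$ by $(e_{i+1}-\langle e_i,e_{i+1}\rangle e_i,\;e_i)$, and for $i=1,\dots,4$ let $\epsilon_i(M)$ be the Gram matrix of the basis obtained by replacing $e_i$ by $-e_i$. These operations define an action of the signed braid group $\Sigma B_4=(\mathbb{Z}/2\mathbb{Z})^4\rtimes B_4$ on the set of exceptional matrices, where $\sigma_1,\sigma_2,\sigma_3$ are the standard generators of the braid group $B_4$, which acts on $(\mathbb{Z}/2\mathbb{Z})^4=\langle\epsilon_1,\dots,\epsilon_4\rangle$ by permuting the factors through the canonical quotient map $B_4\to S_4$. \textbf{Theorem.}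 Let $M$ be an exceptional matrix as above, different from the identity matrix, whose entries satisfy \[ \begin{cases} acdf-abd-ace-bcf-def+a^2+b^2+c^2+d^2+e^2+f^2=0,\\ af-be+cd=0. \end{cases} \] Then, under the action of $\Sigma B_4$, $M$ is equivalent to exactly one of the following matrices: \[ \begin{bmatrix}1&2&2&4\\0&1&0&2\\0&0&1&2\\0&0&0&1\end{bmatrix} \qquad\text{and}\qquad \begin{bmatrix}1&n&2n&n\\0&1&3&3\\0&0&1&3\\0&0&0&1\end{bmatrix}\quad\text{for } n\in\mathbb{N}=\{0,1,2,\dots\}. \] -/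

import Mathlib

/-- An exceptional matrix of rank `4`: an integer `4 × 4` matrix which is upper triangular with
`1`'s on the diagonal. -/
@[ext] structure ExceptionalMatrix where
  toMatrix : Matrix (Fin 4) (Fin 4) ℤ
  diag : ∀ k, toMatrix k k = 1
  lower : ∀ k l, l < k → toMatrix k l = 0

namespace ExceptionalMatrix

/-- The exceptional matrix with entries `a, b, c, d, e, f` above the diagonal. -/
def of (a b c d e f : ℤ) : ExceptionalMatrix where
  toMatrix := !![1, a, b, c; 0, 1, d, e; 0, 0, 1, f; 0, 0, 0, 1]
  diag := by intro k; fin_cases k <;> simp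
  lower := by intro k l h; fin_cases k <;> fin_cases l <;> first | rfl | exact absurd h (by decide)

theorem eq_of (M : ExceptionalMatrix) :
    M = of (M.toMatrix 0 1) (M.toMatrix 0 2) (M.toMatrix 0 3) (M.toMatrix 1 2) (M.toMatrix 1 3)
      (M.toMatrix 2 3) := by
  apply ExceptionalMatrix.ext
  ext k l
  fin_cases k <;> fin_cases l <;>
    first
      | exact M.diag _
      | exact M.lower _ _ (by decide)
      | rfl

/-- The columns of this matrix are the coordinates, with respect to an exceptional basis
`(e_0, e_1, e_2, e_3)` with Gram matrix `M`, of its left mutation at position `i`,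
`(…, e_{i+1} - ⟨e_i, e_{i+1}⟩ e_i, e_i, …)`
(the two displayed vectors are in positions `i` and `i + 1`). -/
def leftBase (i : Fin 3) (M : Matrix (Fin 4) (Fin 4) ℤ) : Matrix (Fin 4) (Fin 4) ℤ :=
  Matrix.of fun k l =>
    if l = i.castSucc then
      (Pi.single i.succ 1 - M i.castSucc i.succ • Pi.single i.castSucc 1 : Fin 4 → ℤ) k
    else if l = i.succ then (Pi.single i.castSucc 1 : Fin 4 → ℤ) k
    else (Pi.single l 1 : Fin 4 → ℤ) k

/-- The columns of this matrix are the coordinates, with respect to an exceptional basis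
`(e_0, e_1, e_2, e_3)` with Gram matrix `M`, of its right mutation at position `i`,
`(…, e_{i+1}, e_i - ⟨e_i, e_{i+1}⟩ e_{i+1}, …)`. -/
def rightBase (i : Fin 3) (M : Matrix (Fin 4) (Fin 4) ℤ) : Matrix (Fin 4) (Fin 4) ℤ :=
  Matrix.of fun k l =>
    if l = i.castSucc then (Pi.single i.succ 1 : Fin 4 → ℤ) k
    else if l = i.succ then
      (Pi.single i.castSucc 1 - M i.castSucc i.succ • Pi.single i.succ 1 : Fin 4 → ℤ) k
    else (Pi.single l 1 : Fin 4 → ℤ) k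

/-- The Gram matrix of the left mutation at `i`. -/
def leftGram (i : Fin 3) (M : Matrix (Fin 4) (Fin 4) ℤ) : Matrix (Fin 4) (Fin 4) ℤ :=
  (leftBase i M).transpose * M * leftBase i M

/-- The Gram matrix of the right mutation at `i`. -/
def rightGram (i : Fin 3) (M : Matrix (Fin 4) (Fin 4) ℤ) : Matrix (Fin 4) (Fin 4) ℤ :=
  (rightBase i M).transpose * M * rightBase i M

theorem leftGram_zero (a b c d e f : ℤ) : leftGram 0 (of a b c d e f).toMatrix =
    (of (-a) (d - a * b) (e - a * c) b c f).toMatrix := by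
  ext k l
  fin_cases k <;> fin_cases l <;>
    simp [leftGram, leftBase, of, Matrix.mul_apply, Fin.sum_univ_four, Pi.single_apply] <;> ring

theorem leftGram_one (a b c d e f : ℤ) : leftGram 1 (of a b c d e f).toMatrix =
    (of (b - d * a) a c (-d) (f - d * e) e).toMatrix := by
  ext k l
  fin_cases k <;> fin_cases l <;>
    simp [leftGram, leftBase, of, Matrix.mul_apply, Fin.sum_univ_four, Pi.single_apply] <;> ring

theorem leftGram_two (a b c d e f : ℤ) : leftGram 2 (of a b c d e f).toMatrix =
    (of a (c - f * b) b (e - f * d) d (-f)).toMatrix := by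
  ext k l
  fin_cases k <;> fin_cases l <;>
    simp [leftGram, leftBase, of, Matrix.mul_apply, Fin.sum_univ_four, Pi.single_apply] <;> ring

theorem rightGram_zero (a b c d e f : ℤ) : rightGram 0 (of a b c d e f).toMatrix =
    (of (-a) d e (b - a * d) (c - a * e) f).toMatrix := by
  ext k l
  fin_cases k <;> fin_cases l <;>
    simp [rightGram, rightBase, of, Matrix.mul_apply, Fin.sum_univ_four, Pi.single_apply] <;> ring

theorem rightGram_one (a b c d e f : ℤ) : rightGram 1 (of a b c d e f).toMatrix =
    (of b (a - d * b) c (-d) f (e - d * f)).toMatrix := by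
  ext k l
  fin_cases k <;> fin_cases l <;>
    simp [rightGram, rightBase, of, Matrix.mul_apply, Fin.sum_univ_four, Pi.single_apply] <;> ring

theorem rightGram_two (a b c d e f : ℤ) : rightGram 2 (of a b c d e f).toMatrix =
    (of a c (b - f * c) e (d - f * e) (-f)).toMatrix := by
  ext k l
  fin_cases k <;> fin_cases l <;>
    simp [rightGram, rightBase, of, Matrix.mul_apply, Fin.sum_univ_four, Pi.single_apply] <;> ring

theorem exists_leftGram (i : Fin 3) (M : ExceptionalMatrix) :
    ∃ N : ExceptionalMatrix, N.toMatrix = leftGram i M.toMatrix := by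
  rw [eq_of M]
  fin_cases i
  · exact ⟨_, (leftGram_zero _ _ _ _ _ _).symm⟩
  · exact ⟨_, (leftGram_one _ _ _ _ _ _).symm⟩
  · exact ⟨_, (leftGram_two _ _ _ _ _ _).symm⟩

theorem exists_rightGram (i : Fin 3) (M : ExceptionalMatrix) :
    ∃ N : ExceptionalMatrix, N.toMatrix = rightGram i M.toMatrix := by
  rw [eq_of M]
  fin_cases i
  · exact ⟨_, (rightGram_zero _ _ _ _ _ _).symm⟩
  · exact ⟨_, (rightGram_one _ _ _ _ _ _).symm⟩
  · exact ⟨_, (rightGram_two _ _ _ _ _ _).symm⟩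

/-- Left mutation at position `i` of an exceptional matrix. -/
def leftMutation (i : Fin 3) (M : ExceptionalMatrix) : ExceptionalMatrix where
  toMatrix := leftGram i M.toMatrix
  diag := by obtain ⟨N, hN⟩ := exists_leftGram i M; rw [← hN]; exact N.diag
  lower := by obtain ⟨N, hN⟩ := exists_leftGram i M; rw [← hN]; exact N.lower

/-- Right mutation at position `i` of an exceptional matrix. -/
def rightMutation (i : Fin 3) (M : ExceptionalMatrix) : ExceptionalMatrix where
  toMatrix := rightGram i M.toMatrix
  diag := by obtain ⟨N, hN⟩ := exists_rightGram i M; rw [← hN]; exact N.diag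
  lower := by obtain ⟨N, hN⟩ := exists_rightGram i M; rw [← hN]; exact N.lower

theorem leftMutation_zero (a b c d e f : ℤ) : leftMutation 0 (of a b c d e f) =
    of (-a) (d - a * b) (e - a * c) b c f :=
  ExceptionalMatrix.ext (leftGram_zero a b c d e f)

theorem leftMutation_one (a b c d e f : ℤ) : leftMutation 1 (of a b c d e f) =
    of (b - d * a) a c (-d) (f - d * e) e :=
  ExceptionalMatrix.ext (leftGram_one a b c d e f)

theorem leftMutation_two (a b c d e f : ℤ) : leftMutation 2 (of a b c d e f) =
    of a (c - f * b) b (e - f * d) d (-f) :=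
  ExceptionalMatrix.ext (leftGram_two a b c d e f)

theorem rightMutation_zero (a b c d e f : ℤ) : rightMutation 0 (of a b c d e f) =
    of (-a) d e (b - a * d) (c - a * e) f :=
  ExceptionalMatrix.ext (rightGram_zero a b c d e f)

theorem rightMutation_one (a b c d e f : ℤ) : rightMutation 1 (of a b c d e f) =
    of b (a - d * b) c (-d) f (e - d * f) :=
  ExceptionalMatrix.ext (rightGram_one a b c d e f)

theorem rightMutation_two (a b c d e f : ℤ) : rightMutation 2 (of a b c d e f) =
    of a c (b - f * c) e (d - f * e) (-f) :=
  ExceptionalMatrix.ext (rightGram_two a b c d e f)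

/-- Left mutation at `i` as a permutation of the set of exceptional matrices; its inverse is the
right mutation at `i`. -/
def mutationPerm (i : Fin 3) : Equiv.Perm ExceptionalMatrix where
  toFun := leftMutation i
  invFun := rightMutation i
  left_inv := by
    intro M
    rw [eq_of M]
    fin_cases i <;>
      simp [leftMutation_zero, leftMutation_one, leftMutation_two, rightMutation_zero,
        rightMutation_one, rightMutation_two]
  right_inv := by
    intro M
    rw [eq_of M]
    fin_cases i <;>
      simp [leftMutation_zero, leftMutation_one, leftMutation_two, rightMutation_zero,
        rightMutation_one, rightMutation_two]

/-- The Gram matrix `(ε_k M_{kl} ε_l)` of the basis obtained by multiplying the `k`-th basis vector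
by the sign `ε_k`. -/
def signChange (ε : Fin 4 → ℤˣ) (M : ExceptionalMatrix) : ExceptionalMatrix where
  toMatrix := Matrix.of fun k l => (ε k : ℤ) * M.toMatrix k l * (ε l : ℤ)
  diag := by intro k; simp [M.diag]
  lower := by intro k l h; simp [M.lower k l h]

theorem signChange_of (ε : Fin 4 → ℤˣ) (a b c d e f : ℤ) : signChange ε (of a b c d e f) =
    of (ε 0 * a * ε 1) (ε 0 * b * ε 2) (ε 0 * c * ε 3) (ε 1 * d * ε 2) (ε 1 * e * ε 3)
      (ε 2 * f * ε 3) :=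
  eq_of _

theorem signChange_one (M : ExceptionalMatrix) : signChange 1 M = M := by
  apply ExceptionalMatrix.ext
  ext k l
  simp [signChange]

theorem signChange_mul (ε δ : Fin 4 → ℤˣ) (M : ExceptionalMatrix) :
    signChange (ε * δ) M = signChange ε (signChange δ M) := by
  apply ExceptionalMatrix.ext
  ext k l
  simp [signChange]
  ring

/-- The action of the sign group `(ℤ/2ℤ)⁴ = {±1}⁴` on exceptional matrices. -/
def signPermHom : (Fin 4 → ℤˣ) →* Equiv.Perm ExceptionalMatrix where
  toFun ε :=
    { toFun := signChange ε
      invFun := signChange ε⁻¹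
      left_inv := fun M => by rw [← signChange_mul, inv_mul_cancel, signChange_one]
      right_inv := fun M => by rw [← signChange_mul, mul_inv_cancel, signChange_one] }
  map_one' := Equiv.ext signChange_one
  map_mul' ε δ := Equiv.ext (signChange_mul ε δ)

end ExceptionalMatrix

/-- The defining relations of Artin's braid group on four strands, with generators
`σ_0, σ_1, σ_2`. -/
def braidRels : Set (FreeGroup (Fin 3)) :=
  let σ : Fin 3 → FreeGroup (Fin 3) := FreeGroup.of
  {σ 0 * σ 1 * σ 0 * (σ 1 * σ 0 * σ 1)⁻¹, σ 1 * σ 2 * σ 1 * (σ 2 * σ 1 * σ 2)⁻¹,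
    σ 0 * σ 2 * (σ 2 * σ 0)⁻¹}

/-- The braid group `B_4`. -/
abbrev BraidGroup4 : Type := PresentedGroup braidRels

/-- The canonical quotient map `B_4 → S_4`, sending `σ_i` to the transposition `(i, i + 1)`. -/
def braidToPerm : BraidGroup4 →* Equiv.Perm (Fin 4) :=
  PresentedGroup.toGroup (f := fun i : Fin 3 => Equiv.swap i.castSucc i.succ) (by
    intro r hr
    rcases hr with rfl | rfl | rfl <;> simp only [map_mul, map_inv, FreeGroup.lift_apply_of] <;>
      decide)

/-- The signed braid group `ΣB_4 = (ℤ/2ℤ)⁴ ⋊ B_4`, where `B_4` acts on `(ℤ/2ℤ)⁴ = {±1}⁴` by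
permuting the coordinates through its quotient `S_4`. -/
abbrev SignedBraidGroup4 : Type :=
  SemidirectProduct (Fin 4 → ℤˣ) BraidGroup4
    ((mulAutArrow (G := Equiv.Perm (Fin 4)) (A := Fin 4) (M := ℤˣ)).comp braidToPerm)

namespace ExceptionalMatrix

/-- The action of `B_4` on exceptional matrices, where `σ_i` acts as the left mutation at `i`. -/
def braidHom : BraidGroup4 →* Equiv.Perm ExceptionalMatrix :=
  PresentedGroup.toGroup (f := mutationPerm) (by
    intro r hr
    rcases hr with rfl | rfl | rfl <;>
      · simp only [map_mul, map_inv, FreeGroup.lift_apply_of, mul_inv_eq_one]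
        ext1 M
        rw [eq_of M]
        simp only [Equiv.Perm.mul_apply, mutationPerm, Equiv.coe_fn_mk, leftMutation_zero,
          leftMutation_one, leftMutation_two]
        congr 1 <;> ring)

theorem mutationPerm_signPermHom (i : Fin 3) (ε : Fin 4 → ℤˣ) :
    mutationPerm i * signPermHom ε =
      signPermHom (fun k => ε (Equiv.swap i.castSucc i.succ k)) * mutationPerm i := by
  have h : ∀ k, (ε k : ℤ) * ε k = 1 := fun k => by
    rw [← Units.val_mul, Int.units_mul_self, Units.val_one]
  have h0 := h 0
  have h1 := h 1
  have h2 := h 2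
  have h3 := h 3
  ext1 M
  rw [eq_of M]
  generalize M.toMatrix 0 1 = a
  generalize M.toMatrix 0 2 = b
  generalize M.toMatrix 0 3 = c
  generalize M.toMatrix 1 2 = d
  generalize M.toMatrix 1 3 = e
  generalize M.toMatrix 2 3 = f
  fin_cases i
  · have s0 : Equiv.swap (Fin.castSucc (0 : Fin 3)) (Fin.succ 0) 0 = 1 := by decide
    have s1 : Equiv.swap (Fin.castSucc (0 : Fin 3)) (Fin.succ 0) 1 = 0 := by decide
    have s2 : Equiv.swap (Fin.castSucc (0 : Fin 3)) (Fin.succ 0) 2 = 2 := by decide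
    have s3 : Equiv.swap (Fin.castSucc (0 : Fin 3)) (Fin.succ 0) 3 = 3 := by decide
    simp only [Equiv.Perm.mul_apply, mutationPerm, signPermHom, MonoidHom.coe_mk, OneHom.coe_mk,
      Equiv.coe_fn_mk, Fin.zero_eta, leftMutation_zero, signChange_of, s0, s1, s2, s3]
    congr 1 <;> grind
  · have s0 : Equiv.swap (Fin.castSucc (1 : Fin 3)) (Fin.succ 1) 0 = 0 := by decide
    have s1 : Equiv.swap (Fin.castSucc (1 : Fin 3)) (Fin.succ 1) 1 = 2 := by decide
    have s2 : Equiv.swap (Fin.castSucc (1 : Fin 3)) (Fin.succ 1) 2 = 1 := by decide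
    have s3 : Equiv.swap (Fin.castSucc (1 : Fin 3)) (Fin.succ 1) 3 = 3 := by decide
    simp only [Equiv.Perm.mul_apply, mutationPerm, signPermHom, MonoidHom.coe_mk, OneHom.coe_mk,
      Equiv.coe_fn_mk, Fin.mk_one, leftMutation_one, signChange_of, s0, s1, s2, s3]
    congr 1 <;> grind
  · have s0 : Equiv.swap (Fin.castSucc (2 : Fin 3)) (Fin.succ 2) 0 = 0 := by decide
    have s1 : Equiv.swap (Fin.castSucc (2 : Fin 3)) (Fin.succ 2) 1 = 1 := by decide
    have s2 : Equiv.swap (Fin.castSucc (2 : Fin 3)) (Fin.succ 2) 2 = 3 := by decide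
    have s3 : Equiv.swap (Fin.castSucc (2 : Fin 3)) (Fin.succ 2) 3 = 2 := by decide
    simp only [Equiv.Perm.mul_apply, mutationPerm, signPermHom, MonoidHom.coe_mk, OneHom.coe_mk,
      Equiv.coe_fn_mk, Fin.reduceFinMk, leftMutation_two, signChange_of, s0, s1, s2, s3]
    congr 1 <;> grind

theorem braidHom_conj (g : BraidGroup4) (ε : Fin 4 → ℤˣ) :
    signPermHom (mulAutArrow (braidToPerm g) ε) = braidHom g * signPermHom ε * (braidHom g)⁻¹ := by
  have hgen : ∀ (i : Fin 3) (δ : Fin 4 → ℤˣ),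
      signPermHom (mulAutArrow (braidToPerm (PresentedGroup.of i)) δ) =
        braidHom (PresentedGroup.of i) * signPermHom δ * (braidHom (PresentedGroup.of i))⁻¹ := by
    intro i δ
    rw [eq_mul_inv_iff_mul_eq]
    have hb : braidHom (PresentedGroup.of i) = mutationPerm i := PresentedGroup.toGroup.of _
    have hp : braidToPerm (PresentedGroup.of i) = Equiv.swap i.castSucc i.succ :=
      PresentedGroup.toGroup.of _
    rw [hb, hp, mutationPerm_signPermHom]
    rfl
  let S : Subgroup BraidGroup4 :=
    { carrier := {g | ∀ δ : Fin 4 → ℤˣ, signPermHom (mulAutArrow (braidToPerm g) δ) =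
        braidHom g * signPermHom δ * (braidHom g)⁻¹}
      one_mem' := fun δ => by simp
      mul_mem' := fun {x y} hx hy δ => by
        rw [map_mul, map_mul, MulAut.mul_apply, hx, hy, map_mul]
        group
      inv_mem' := fun {x} hx δ => by
        have := hx ((mulAutArrow (braidToPerm x⁻¹)) δ)
        rw [← MulAut.mul_apply, ← map_mul, ← map_mul, mul_inv_cancel, map_one, map_one,
          MulAut.one_apply] at this
        rw [this, map_inv braidHom x, inv_inv]
        simp only [mul_assoc, inv_mul_cancel_left, inv_mul_cancel, mul_one] }
  have hS : g ∈ S := by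
    have hle : Subgroup.closure (Set.range (PresentedGroup.of (rels := braidRels))) ≤ S := by
      rw [Subgroup.closure_le]
      rintro _ ⟨i, rfl⟩
      exact hgen i
    rw [PresentedGroup.closure_range_of] at hle
    exact hle (Subgroup.mem_top g)
  exact hS ε

/-- The action of the signed braid group `ΣB_4` on exceptional matrices: `B_4` acts by mutations
and `(ℤ/2ℤ)⁴` acts by changing the signs of the basis vectors. -/
def signedBraidHom : SignedBraidGroup4 →* Equiv.Perm ExceptionalMatrix :=
  SemidirectProduct.lift signPermHom braidHom (by
    intro g
    ext1 ε
    exact braidHom_conj g ε)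

instance : MulAction SignedBraidGroup4 ExceptionalMatrix :=
  MulAction.compHom ExceptionalMatrix signedBraidHom

/-- The list of normal forms: the matrix of `ℙ¹ × ℙ¹`, and the family indexed by `n ∈ ℕ`
(including `n = 0`). -/
def normalForms : Set ExceptionalMatrix :=
  {of 2 2 4 0 2 2} ∪ Set.range fun n : ℕ => of n (2 * n) n 3 3 3

end ExceptionalMatrix

/-!
Write `A = M - Mᵀ`. The two equations say that the Serre operator of the form is unipotent; unless
`A M⁻¹ A = 0` this produces an isotropic vector `p` in the kernel of `A`, and every basis vector `e_i`
gets a rank `⟨e_i, p⟩` (`IsRankVector`). Mutations act on the ranks `(r, s, t, u)` by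
`(r, s) ↦ (s - ar, r)`, and the helix rotation permutes them cyclically.

*Descent.* A mutation of the first two vectors decreases the sum of the squares of the ranks as soon
as `x = r² + s² - ars` lies strictly between `-|r² - s²|` and `r² + s²`. By isotropy of `p`, the
numbers of this kind for the four pairs of cyclic neighbours are `x, y, -x, -y`, and they satisfy the
Plücker relation `xy = r²t² - s²u²` (`IsRankVector.plucker`). If all ranks are nonzero and no
mutation decreases them, comparing sizes forces, up to rotation, `x = 0`, `r² = s²` and `t² = u²`
(`eq_zero_of_no_decrease`). Such matrices form three explicit families indexed by `ℤ`
(`IsRankVector.hasNormalForm_of_sq_eq`), each of which is reduced by hand to a normal form.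

*Rank zero.* If `e_0` has rank zero, then the remaining three vectors satisfy the Markov equation
`d² + e² + f² = def` (`IsRankVector.markov`). Vieta jumps, which are mutations up to signs, bring
`(d, e, f)` to `(3, 3, 3)` unless it is zero, which forces `M = 1`; the two equations then leave only
the family indexed by `ℕ`. No ranks are needed if the Markov equation holds from the start; otherwise
a rank vector with nonzero first entry is read off from `A M⁻¹ A` (`IsSolution.isRankVector`).

*Uniqueness.* Equivalent matrices are congruent over `ℤ`, so the divisors of all entries of `A` and
of `A M⁻¹ A` are invariants. The second matrix has content `|9 - n²|` for the member `n` of the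
family, which determines `n`; divisibility of `A` by `2` singles out the matrix of `ℙ¹ × ℙ¹`.
-/

namespace ExceptionalMatrix

/-! ### Equivalence under the signed braid group -/

/-- Two exceptional matrices are equivalent if they lie in the same orbit of `ΣB_4`. -/
def MutationEquiv (M N : ExceptionalMatrix) : Prop := ∃ g : SignedBraidGroup4, g • M = N

namespace MutationEquiv

theorem symm {M N : ExceptionalMatrix} (h : MutationEquiv M N) : MutationEquiv N M := by
  obtain ⟨g, rfl⟩ := h
  exact ⟨g⁻¹, inv_smul_smul g M⟩

theorem trans {L M N : ExceptionalMatrix} (h : MutationEquiv L M) (h' : MutationEquiv M N) :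
    MutationEquiv L N := by
  obtain ⟨g, rfl⟩ := h
  obtain ⟨g', rfl⟩ := h'
  exact ⟨g' * g, mul_smul g' g L⟩

theorem refl (M : ExceptionalMatrix) : MutationEquiv M M := ⟨1, one_smul _ M⟩

theorem left (i : Fin 3) (M : ExceptionalMatrix) : MutationEquiv M (leftMutation i M) := by
  refine ⟨SemidirectProduct.inr (PresentedGroup.of i), ?_⟩
  change signedBraidHom (SemidirectProduct.inr (PresentedGroup.of i)) M = _
  have hb : braidHom (PresentedGroup.of i) = mutationPerm i := PresentedGroup.toGroup.of _
  rw [signedBraidHom, SemidirectProduct.lift_inr, hb]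
  rfl

theorem right (i : Fin 3) (M : ExceptionalMatrix) : MutationEquiv M (rightMutation i M) := by
  have h := left i (rightMutation i M)
  have h' : leftMutation i (rightMutation i M) = M := (mutationPerm i).right_inv M
  rw [h'] at h
  exact h.symm

theorem sign (ε : Fin 4 → ℤˣ) (M : ExceptionalMatrix) : MutationEquiv M (signChange ε M) := by
  refine ⟨SemidirectProduct.inl ε, ?_⟩
  change signedBraidHom (SemidirectProduct.inl ε) M = _
  rw [signedBraidHom, SemidirectProduct.lift_inl]
  rfl

theorem left_zero (a b c d e f : ℤ) :
    MutationEquiv (of a b c d e f) (of (-a) (d - a * b) (e - a * c) b c f) :=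
  leftMutation_zero a b c d e f ▸ left 0 _

theorem left_one (a b c d e f : ℤ) :
    MutationEquiv (of a b c d e f) (of (b - d * a) a c (-d) (f - d * e) e) :=
  leftMutation_one a b c d e f ▸ left 1 _

theorem left_two (a b c d e f : ℤ) :
    MutationEquiv (of a b c d e f) (of a (c - f * b) b (e - f * d) d (-f)) :=
  leftMutation_two a b c d e f ▸ left 2 _

theorem right_zero (a b c d e f : ℤ) :
    MutationEquiv (of a b c d e f) (of (-a) d e (b - a * d) (c - a * e) f) :=
  rightMutation_zero a b c d e f ▸ right 0 _

theorem right_one (a b c d e f : ℤ) :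
    MutationEquiv (of a b c d e f) (of b (a - d * b) c (-d) f (e - d * f)) :=
  rightMutation_one a b c d e f ▸ right 1 _

theorem right_two (a b c d e f : ℤ) :
    MutationEquiv (of a b c d e f) (of a c (b - f * c) e (d - f * e) (-f)) :=
  rightMutation_two a b c d e f ▸ right 2 _

theorem sign_of (p q v w : ℤˣ) (a b c d e f : ℤ) :
    MutationEquiv (of a b c d e f)
      (of (p * a * q) (p * b * v) (p * c * w) (q * d * v) (q * e * w) (v * f * w)) :=
  signChange_of ![p, q, v, w] a b c d e f ▸ sign ![p, q, v, w] _

theorem neg_zero (a b c d e f : ℤ) :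
    MutationEquiv (of a b c d e f) (of (-a) (-b) (-c) d e f) := by
  simpa using sign_of (-1) 1 1 1 a b c d e f

theorem neg_one (a b c d e f : ℤ) :
    MutationEquiv (of a b c d e f) (of (-a) b c (-d) (-e) f) := by
  simpa using sign_of 1 (-1) 1 1 a b c d e f

theorem neg_two (a b c d e f : ℤ) :
    MutationEquiv (of a b c d e f) (of a (-b) c (-d) e (-f)) := by
  simpa using sign_of 1 1 (-1) 1 a b c d e f

theorem neg_three (a b c d e f : ℤ) :
    MutationEquiv (of a b c d e f) (of a b (-c) d (-e) (-f)) := by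
  simpa using sign_of 1 1 1 (-1) a b c d e f

/-- The helix rotation: `(e_0, e_1, e_2, e_3)` is equivalent to `(e_1, e_2, e_3, e_0')`, where `e_0'`
is the right mutation of `e_0` past the other three vectors. -/
theorem rotate (a b c d e f v w : ℤ) (hv : v = b - a * d) (hw : w = c - a * e - v * f) :
    MutationEquiv (of a b c d e f) (of d e (-a - v * d - w * e) f (-v - w * f) (-w)) := by
  subst hw hv
  exact ((right_zero a b c d e f).trans (right_one _ _ _ _ _ _)).trans (right_two _ _ _ _ _ _)

/-- A family of exceptional matrices indexed by `ℤ` whose consecutive members are equivalent lies in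
one orbit. -/
theorem of_succ {F : ℤ → ExceptionalMatrix} (h : ∀ k, MutationEquiv (F k) (F (k + 1))) (k l : ℤ) :
    MutationEquiv (F k) (F l) := by
  have h0 : ∀ k, MutationEquiv (F 0) (F k) := fun k => by
    induction k with
    | zero => exact refl _
    | succ k ih => exact ih.trans (h k)
    | pred k ih =>
      have := h (-(k : ℤ) - 1)
      rw [sub_add_cancel] at this
      exact ih.trans this.symm
  exact (h0 k).symm.trans (h0 l)

end MutationEquiv

/-- An exceptional matrix is equivalent to one of the normal forms. -/
def HasNormalForm (M : ExceptionalMatrix) : Prop := ∃ N ∈ normalForms, MutationEquiv M N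

theorem MutationEquiv.hasNormalForm {M N : ExceptionalMatrix} (h : MutationEquiv M N)
    (hN : HasNormalForm N) : HasNormalForm M := by
  obtain ⟨L, hL, h'⟩ := hN
  exact ⟨L, hL, h.trans h'⟩

theorem hasNormalForm_of_nat (n : ℕ) : HasNormalForm (of n (2 * n) n 3 3 3) :=
  ⟨_, Or.inr ⟨n, rfl⟩, .refl _⟩

/-! ### Solutions and rank vectors -/

/-- The entries `a, …, f` solve the two equations, which say that the Serre operator of the form is
unipotent. -/
structure IsSolution (a b c d e f : ℤ) : Prop where
  quartic : a * c * d * f - a * b * d - a * c * e - b * c * f - d * e * f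
      + a ^ 2 + b ^ 2 + c ^ 2 + d ^ 2 + e ^ 2 + f ^ 2 = 0
  pfaffian : a * f - b * e + c * d = 0

/-- The numbers `r, s, t, u` are the ranks `⟨e_i, p⟩` of the basis vectors with respect to an
isotropic vector `p` fixed by the Serre operator and orthogonal to all vectors it fixes. Writing `M`
for the Gram matrix, `A` for `M - Mᵀ`, the vector of ranks `ρ` satisfies: `ρ` lies in the
rational column space of `A` (the fields `image`, which hold because `A` has rank two), `p = M⁻¹ ρ`
lies in the kernel of `A` (the fields `kernel`), and `⟨p, p⟩ = 0` (the field `null`, simplified by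
means of the others). -/
structure IsRankVector (a b c d e f r s t u : ℤ) : Prop extends IsSolution a b c d e f where
  image₀₁₂ : r * d - s * b + t * a = 0
  image₀₁₃ : r * e - s * c + u * a = 0
  image₀₂₃ : r * f - t * c + u * b = 0
  image₁₂₃ : s * f - t * e + u * d = 0
  kernel₀ : a * (s - a * r) + b * (t - f * u) + c * u = 0
  kernel₁ : -a * r + d * (t - f * u) + e * u = 0
  kernel₂ : -b * r - d * (s - a * r) + f * u = 0
  kernel₃ : c * r + e * (s - a * r) + f * (t - f * u) = 0
  null : r ^ 2 + s ^ 2 - a * r * s + t ^ 2 + u ^ 2 - f * t * u = 0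

variable {a b c d e f r s t u : ℤ}

namespace IsSolution

theorem left_one (h : IsSolution a b c d e f) :
    IsSolution (b - d * a) a c (-d) (f - d * e) e := by
  obtain ⟨h₁, h₂⟩ := h
  constructor <;> grind

theorem left_zero (h : IsSolution a b c d e f) :
    IsSolution (-a) (d - a * b) (e - a * c) b c f := by
  obtain ⟨h₁, h₂⟩ := h
  constructor <;> grind

theorem right_zero (h : IsSolution a b c d e f) :
    IsSolution (-a) d e (b - a * d) (c - a * e) f := by
  obtain ⟨h₁, h₂⟩ := h
  constructor <;> grind

theorem right_one (h : IsSolution a b c d e f) :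
    IsSolution b (a - d * b) c (-d) f (e - d * f) := by
  obtain ⟨h₁, h₂⟩ := h
  constructor <;> grind

theorem right_two (h : IsSolution a b c d e f) :
    IsSolution a c (b - f * c) e (d - f * e) (-f) := by
  obtain ⟨h₁, h₂⟩ := h
  constructor <;> grind

theorem sign_of (h : IsSolution a b c d e f) (p q v w : ℤˣ) :
    IsSolution (p * a * q) (p * b * v) (p * c * w) (q * d * v) (q * e * w) (v * f * w) := by
  obtain ⟨h₁, h₂⟩ := h
  have hp : (p : ℤ) ^ 2 = 1 := by rw [← Units.val_pow_eq_pow_val, Int.units_sq, Units.val_one]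
  have hq : (q : ℤ) ^ 2 = 1 := by rw [← Units.val_pow_eq_pow_val, Int.units_sq, Units.val_one]
  have hv : (v : ℤ) ^ 2 = 1 := by rw [← Units.val_pow_eq_pow_val, Int.units_sq, Units.val_one]
  have hw : (w : ℤ) ^ 2 = 1 := by rw [← Units.val_pow_eq_pow_val, Int.units_sq, Units.val_one]
  constructor <;> grind

/-- The first row of `(M - Mᵀ) M⁻¹ (M - Mᵀ)` satisfies the equations of a rank vector; its first
entry is `d² + e² + f² - def`. -/
theorem isRankVector (h : IsSolution a b c d e f) {w : ℤ}
    (hw : w = c - b * f + a * d * f - a * e) :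
    IsRankVector a b c d e f (d ^ 2 + e ^ 2 + f ^ 2 - d * e * f) (-d * (b - a * d) - e * w)
      (a * d - f * w) (a * e + f * (b - a * d)) := by
  obtain ⟨h₁, h₂⟩ := h
  constructor
  · constructor <;> assumption
  all_goals grind

end IsSolution

namespace IsRankVector

theorem right_zero (h : IsRankVector a b c d e f r s t u) :
    IsRankVector (-a) d e (b - a * d) (c - a * e) f s (r - a * s) t u := by
  refine ⟨h.toIsSolution.right_zero, ?_, ?_, ?_, ?_, ?_, ?_, ?_, ?_, ?_⟩ <;>
  · obtain ⟨-, h1, h2, h3, h4, h5, h6, h7, h8, h9⟩ := h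
    grind

theorem left_zero (h : IsRankVector a b c d e f r s t u) :
    IsRankVector (-a) (d - a * b) (e - a * c) b c f (s - a * r) r t u := by
  refine ⟨h.toIsSolution.left_zero, ?_, ?_, ?_, ?_, ?_, ?_, ?_, ?_, ?_⟩ <;>
  · obtain ⟨-, h1, h2, h3, h4, h5, h6, h7, h8, h9⟩ := h
    grind

theorem right_one (h : IsRankVector a b c d e f r s t u) :
    IsRankVector b (a - d * b) c (-d) f (e - d * f) r t (s - d * t) u := by
  refine ⟨h.toIsSolution.right_one, ?_, ?_, ?_, ?_, ?_, ?_, ?_, ?_, ?_⟩ <;>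
  · obtain ⟨-, h1, h2, h3, h4, h5, h6, h7, h8, h9⟩ := h
    grind

theorem right_two (h : IsRankVector a b c d e f r s t u) :
    IsRankVector a c (b - f * c) e (d - f * e) (-f) r s u (t - f * u) := by
  refine ⟨h.toIsSolution.right_two, ?_, ?_, ?_, ?_, ?_, ?_, ?_, ?_, ?_⟩ <;>
  · obtain ⟨-, h1, h2, h3, h4, h5, h6, h7, h8, h9⟩ := h
    grind

theorem sign_of (h : IsRankVector a b c d e f r s t u) (p q v w : ℤˣ) :
    IsRankVector (p * a * q) (p * b * v) (p * c * w) (q * d * v) (q * e * w) (v * f * w)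
      (p * r) (q * s) (v * t) (w * u) := by
  have hp : (p : ℤ) ^ 2 = 1 := by rw [← Units.val_pow_eq_pow_val, Int.units_sq, Units.val_one]
  have hq : (q : ℤ) ^ 2 = 1 := by rw [← Units.val_pow_eq_pow_val, Int.units_sq, Units.val_one]
  have hv : (v : ℤ) ^ 2 = 1 := by rw [← Units.val_pow_eq_pow_val, Int.units_sq, Units.val_one]
  have hw : (w : ℤ) ^ 2 = 1 := by rw [← Units.val_pow_eq_pow_val, Int.units_sq, Units.val_one]
  refine ⟨h.toIsSolution.sign_of p q v w, ?_, ?_, ?_, ?_, ?_, ?_, ?_, ?_, ?_⟩ <;>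
  · obtain ⟨-, h1, h2, h3, h4, h5, h6, h7, h8, h9⟩ := h
    grind

/-- The vector `e_0'` of the helix rotation has the same rank as `e_0`. -/
theorem rotate (h : IsRankVector a b c d e f r s t u) {v w : ℤ} (hv : v = b - a * d)
    (hw : w = c - a * e - v * f) :
    IsRankVector d e (-a - v * d - w * e) f (-v - w * f) (-w) s t u r := by
  have hr : r - a * s - v * t - w * u = r := by
    linear_combination -h.kernel₀ + a * h.kernel₁ - t * hv - u * hw + u * f * hv
  subst hw hv
  exact hr ▸ h.right_zero.right_one.right_two

/-- The Plücker relation between the four ranks. -/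
theorem plucker (h : IsRankVector a b c d e f r s t u) :
    (r ^ 2 + s ^ 2 - a * r * s) * (s ^ 2 + t ^ 2 - d * s * t) = r ^ 2 * t ^ 2 - s ^ 2 * u ^ 2 := by
  obtain ⟨-, h1, h2, h3, h4, h5, h6, h7, h8, h9⟩ := h
  grind

/-- If `e_0` has rank zero, then the other three vectors satisfy the Markov equation. -/
theorem markov (h : IsRankVector a b c d e f 0 s t u) (h0 : 0 < s ^ 2 + t ^ 2 + u ^ 2) :
    d ^ 2 + e ^ 2 + f ^ 2 = d * e * f := by
  obtain ⟨-, -, -, -, -, -, h2, h3, h4, hn⟩ := h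
  -- `p` is proportional to `(0, f, -e, d)`, so `⟨p, p⟩` is a multiple of `d² + e² + f² - def`
  have hs : s ^ 2 * (d ^ 2 + e ^ 2 + f ^ 2 - d * e * f) = 0 := by grind
  have ht : (t - f * u) ^ 2 * (d ^ 2 + e ^ 2 + f ^ 2 - d * e * f) = 0 := by grind
  have hu : u ^ 2 * (d ^ 2 + e ^ 2 + f ^ 2 - d * e * f) = 0 := by grind
  by_contra hne
  have hne' : d ^ 2 + e ^ 2 + f ^ 2 - d * e * f ≠ 0 := sub_ne_zero.mpr hne
  have hs0 : s = 0 := by simpa [hne'] using hs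
  have hu0 : u = 0 := by simpa [hne'] using hu
  have ht0 : t = 0 := by simpa [hne', hu0] using ht
  simp [hs0, ht0, hu0] at h0

end IsRankVector

/-! ### Markov triples -/

/-- An ordered Markov triple that no Vieta jump decreases is `(3, 3, 3)`. -/
theorem eq_three_of_markov_of_le {x y z : ℤ} (hx : 0 < x) (hxy : x ≤ y) (hyz : y ≤ z)
    (h : x ^ 2 + y ^ 2 + z ^ 2 = x * y * z) (hz : 2 * z ≤ x * y) : x = 3 ∧ y = 3 ∧ z = 3 := by
  -- the polynomial `z² - xyz` in `z` decreases on `[y, xy / 2]`, so it is at most `y² - xy²`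
  have h1 : (x - 2) * y ^ 2 ≤ x ^ 2 := by
    nlinarith [mul_nonneg (sub_nonneg.2 hyz) (by linarith : 0 ≤ x * y - z - y)]
  have hx3 : x ≤ 3 := by nlinarith
  have hx' : x = 1 ∨ x = 2 ∨ x = 3 := by omega
  rcases hx' with rfl | rfl | rfl
  · nlinarith [sq_nonneg (y - z)]
  · nlinarith [sq_nonneg (y - z)]
  · have hy : y = 3 := by nlinarith
    subst hy
    exact ⟨rfl, rfl, by nlinarith⟩

theorem eq_three_of_markov {x y z : ℤ} (hx : 0 < x) (hy : 0 < y) (hz : 0 < z)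
    (h : x ^ 2 + y ^ 2 + z ^ 2 = x * y * z) (h₁ : 2 * x ≤ y * z) (h₂ : 2 * y ≤ x * z)
    (h₃ : 2 * z ≤ x * y) : x = 3 ∧ y = 3 ∧ z = 3 := by
  rcases le_total x y with hxy | hxy <;> rcases le_total y z with hyz | hyz <;>
    rcases le_total x z with hxz | hxz
  · exact eq_three_of_markov_of_le hx hxy hyz h h₃
  · exact eq_three_of_markov_of_le hx hxy hyz h h₃
  · have := eq_three_of_markov_of_le hx hxz hyz (by linarith) (by linarith)
    tauto
  · have := eq_three_of_markov_of_le hz hxz hxy (by linarith) (by linarith)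
    tauto
  · have := eq_three_of_markov_of_le hy hxy hxz (by linarith) (by linarith)
    tauto
  · have := eq_three_of_markov_of_le hy hyz hxz (by linarith) (by linarith)
    tauto
  · have := eq_three_of_markov_of_le hz hyz hxy (by linarith) (by linarith)
    tauto
  · have := eq_three_of_markov_of_le hz hyz hxy (by linarith) (by linarith)
    tauto

/-- The Vieta jump `z ↦ xy - z` preserves positivity of Markov triples. -/
theorem vieta_pos {x y z : ℤ} (hx : 0 < x) (hz : 0 < z)
    (h : x ^ 2 + y ^ 2 + z ^ 2 = x * y * z) : 0 < x * y - z := by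
  have : 0 < (x * y - z) * z := by nlinarith [sq_nonneg y, pow_pos hx 2]
  exact pos_of_mul_pos_left this hz.le

theorem IsSolution.hasNormalForm_of_three (h : IsSolution a b c 3 3 3) :
    HasNormalForm (of a b c 3 3 3) := by
  obtain ⟨h₁, h₂⟩ := h
  have hb : b = a + c := by linarith
  subst hb
  have hc : (c - a) ^ 2 = 0 := by linarith
  have hc' : c = a := sub_eq_zero.1 (pow_eq_zero_iff two_ne_zero |>.1 hc)
  subst hc'
  rcases Int.eq_nat_or_neg c with ⟨n, rfl | rfl⟩
  · rw [← two_mul]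
    exact hasNormalForm_of_nat n
  · refine (MutationEquiv.neg_zero _ _ _ _ _ _).hasNormalForm ?_
    rw [← two_mul, neg_neg, mul_neg, neg_neg]
    exact hasNormalForm_of_nat n

/-- Descent by Vieta jumps on the triple `(d, e, f)`; each jump is a mutation up to signs. -/
theorem IsSolution.hasNormalForm_of_markov_pos (k : ℕ) : ∀ {a b c d e f : ℤ},
    IsSolution a b c d e f → 0 < d → 0 < e → 0 < f → d ^ 2 + e ^ 2 + f ^ 2 = d * e * f →
      d + e + f ≤ k → HasNormalForm (of a b c d e f) := by
  induction k with
  | zero => intros; push_cast at *; omega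
  | succ k ih =>
    intro a b c d e f h hd he hf hm hk
    push_cast at hk
    by_cases h₁ : 2 * d ≤ e * f
    · by_cases h₂ : 2 * e ≤ d * f
      · by_cases h₃ : 2 * f ≤ d * e
        · obtain ⟨rfl, rfl, rfl⟩ := eq_three_of_markov hd he hf hm h₁ h₂ h₃
          exact h.hasNormalForm_of_three
        · refine ((MutationEquiv.left_one a b c d e f).trans (.neg_one _ _ _ _ _ _)).hasNormalForm ?_
          refine ih (by simpa using h.left_one.sign_of 1 (-1) 1 1) ?_ ?_ he ?_ ?_
          · linarith
          · have := vieta_pos hd hf hm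
            linarith
          · linear_combination hm
          · linarith
      · refine ((MutationEquiv.right_one a b c d e f).trans (.neg_two _ _ _ _ _ _)).hasNormalForm ?_
        refine ih (by simpa using h.right_one.sign_of 1 1 (-1) 1) ?_ hf ?_ ?_ ?_
        · linarith
        · have := vieta_pos (y := f) hd he (by linarith)
          linarith
        · linear_combination hm
        · linarith
    · refine ((MutationEquiv.right_two a b c d e f).trans (.neg_three _ _ _ _ _ _)).hasNormalForm ?_
      refine ih (by simpa using h.right_two.sign_of 1 1 1 (-1)) he ?_ ?_ ?_ ?_
      · have := vieta_pos (y := f) he hd (by linarith)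
        linarith
      · linarith
      · linear_combination hm
      · linarith

theorem exists_sign (x : ℤ) : ∃ ε : ℤˣ, (ε : ℤ) * x = |x| := by
  rcases abs_cases x with ⟨h, -⟩ | ⟨h, -⟩
  · exact ⟨1, by simp [h]⟩
  · exact ⟨-1, by simp [h]⟩

theorem IsSolution.hasNormalForm_of_markov (h : IsSolution a b c d e f)
    (hm : d ^ 2 + e ^ 2 + f ^ 2 = d * e * f)
    (hne : ¬(a = 0 ∧ b = 0 ∧ c = 0 ∧ d = 0 ∧ e = 0 ∧ f = 0)) :
    HasNormalForm (of a b c d e f) := by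
  have hdef : d * e * f ≠ 0 := by
    intro h0
    rw [h0] at hm
    have hd : d = 0 := by nlinarith [sq_nonneg d, sq_nonneg e, sq_nonneg f]
    have he : e = 0 := by nlinarith [sq_nonneg d, sq_nonneg e, sq_nonneg f]
    have hf : f = 0 := by nlinarith [sq_nonneg d, sq_nonneg e, sq_nonneg f]
    subst hd he hf
    have h₁ := h.quartic
    have ha : a = 0 := by nlinarith [sq_nonneg a, sq_nonneg b, sq_nonneg c]
    have hb : b = 0 := by nlinarith [sq_nonneg a, sq_nonneg b, sq_nonneg c]
    have hc : c = 0 := by nlinarith [sq_nonneg a, sq_nonneg b, sq_nonneg c]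
    exact hne ⟨ha, hb, hc, rfl, rfl, rfl⟩
  have hd0 : d ≠ 0 := by rintro rfl; simp at hdef
  have he0 : e ≠ 0 := by rintro rfl; simp at hdef
  have hf0 : f ≠ 0 := by rintro rfl; simp at hdef
  obtain ⟨v, hv⟩ := exists_sign d
  obtain ⟨w, hw⟩ := exists_sign e
  have hpos : 0 < d * e * f := by
    rw [← hm]
    have := pow_pos (abs_pos.2 hd0) 2
    rw [sq_abs] at this
    nlinarith [sq_nonneg e, sq_nonneg f]
  have hd : 0 < ((1 : ℤˣ) : ℤ) * d * v := by
    rw [Units.val_one, one_mul, mul_comm, hv]; exact abs_pos.2 hd0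
  have he : 0 < ((1 : ℤˣ) : ℤ) * e * w := by
    rw [Units.val_one, one_mul, mul_comm, hw]; exact abs_pos.2 he0
  have hv2 : (v : ℤ) ^ 2 = 1 := by
    rw [← Units.val_pow_eq_pow_val, Int.units_sq, Units.val_one]
  have hw2 : (w : ℤ) ^ 2 = 1 := by
    rw [← Units.val_pow_eq_pow_val, Int.units_sq, Units.val_one]
  have hf : 0 < (v : ℤ) * f * w := by
    refine pos_of_mul_pos_right (a := ((1 : ℤˣ) : ℤ) * d * v * (((1 : ℤˣ) : ℤ) * e * w)) ?_
      (mul_pos hd he).le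
    rw [Units.val_one]
    have : d * e * f = 1 * d * v * (1 * e * w) * (v * f * w) := by grind
    exact this ▸ hpos
  refine (MutationEquiv.sign_of 1 1 v w a b c d e f).hasNormalForm ?_
  refine IsSolution.hasNormalForm_of_markov_pos _ (h.sign_of 1 1 v w) hd he hf ?_
    (Int.self_le_toNat _)
  rw [Units.val_one]
  grind

/-! ### Descent on the ranks -/

theorem IsRankVector.hasNormalForm_of_zero (h : IsRankVector a b c d e f 0 s t u)
    (h0 : 0 < s ^ 2 + t ^ 2 + u ^ 2) : HasNormalForm (of a b c d e f) := by
  refine h.toIsSolution.hasNormalForm_of_markov (h.markov h0) ?_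
  rintro ⟨rfl, rfl, rfl, rfl, rfl, rfl⟩
  have := h.null
  linarith

/-- The matrices of rank vector `(1, 1, 1, 1)`: up to equivalence the integer `d` matters only
modulo `2`. -/
theorem hasNormalForm_two_two (d : ℤ) : HasNormalForm (of 2 (d + 2) (d + 4) d (d + 2) 2) := by
  have step : ∀ d : ℤ, MutationEquiv (of 2 (d + 2) (d + 4) d (d + 2) 2)
      (of 2 (d + 2 + 2) (d + 2 + 4) (d + 2) (d + 2 + 2) 2) := fun d => by
    convert (MutationEquiv.left_zero 2 (d + 2) (d + 4) d (d + 2) 2).trans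
      (.neg_zero _ _ _ _ _ _) using 2 <;> ring
  rcases Int.even_or_odd' d with ⟨k, rfl | rfl⟩
  · have h := MutationEquiv.of_succ
      (F := fun k => of 2 (2 * k + 2) (2 * k + 4) (2 * k) (2 * k + 2) 2)
      (fun k => by convert step (2 * k) using 2 <;> ring) k 0
    exact h.hasNormalForm ⟨_, Or.inl rfl, by simpa using .refl _⟩
  · have h := MutationEquiv.of_succ
      (F := fun k => of 2 (2 * k + 1 + 2) (2 * k + 1 + 4) (2 * k + 1) (2 * k + 1 + 2) 2)
      (fun k => by convert step (2 * k + 1) using 2 <;> ring) k 0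
    refine h.hasNormalForm ?_
    have h' := ((((MutationEquiv.left_one 2 3 5 1 3 2).trans (.left_two _ _ _ _ _ _)).trans
      (.neg_two _ _ _ _ _ _)).trans (.right_zero _ _ _ _ _ _)).trans (.neg_zero _ _ _ _ _ _)
    norm_num at h' ⊢
    exact h'.hasNormalForm (by simpa using hasNormalForm_of_nat 1)

/-- The matrices of rank vector `(2, 2, 1, 1)`. -/
theorem hasNormalForm_one_four (d : ℤ) : HasNormalForm (of 2 (d + 1) (d + 5) d (d + 4) 2) := by
  have h := MutationEquiv.of_succ (F := fun d => of 2 (d + 1) (d + 5) d (d + 4) 2)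
    (fun d => by
      convert (MutationEquiv.left_zero 2 (d + 1) (d + 5) d (d + 4) 2).trans
        (.neg_zero _ _ _ _ _ _) using 2 <;> ring) d 1
  refine h.hasNormalForm ?_
  have h' := ((((((MutationEquiv.right_one 2 2 6 1 5 2).trans (.neg_two _ _ _ _ _ _)).trans
    (.left_two _ _ _ _ _ _)).trans (.right_zero _ _ _ _ _ _)).trans
    (.neg_one _ _ _ _ _ _)).trans (.right_zero _ _ _ _ _ _)).trans (.neg_one _ _ _ _ _ _)
  norm_num at h' ⊢
  exact h'.hasNormalForm (by simpa using hasNormalForm_of_nat 2)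

/-- The matrices of rank vector `(1, 1, 2, 2)`. -/
theorem hasNormalForm_four_one (d : ℤ) : HasNormalForm (of 2 (d + 4) (d + 5) d (d + 1) 2) := by
  have h := MutationEquiv.of_succ (F := fun d => of 2 (d + 4) (d + 5) d (d + 1) 2)
    (fun d => by
      convert (MutationEquiv.right_two 2 (d + 4) (d + 5) d (d + 1) 2).trans
        (.neg_three _ _ _ _ _ _) using 2 <;> ring) d 1
  refine h.hasNormalForm ?_
  have h' := (((((((MutationEquiv.left_one 2 5 6 1 2 2).trans (.left_two _ _ _ _ _ _)).trans
    (.right_zero _ _ _ _ _ _)).trans (.sign_of 1 (-1) 1 (-1) _ _ _ _ _ _)).trans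
    (.right_one _ _ _ _ _ _)).trans (.neg_two _ _ _ _ _ _)).trans
    (.right_zero _ _ _ _ _ _)).trans (.neg_one _ _ _ _ _ _)
  norm_num at h' ⊢
  exact h'.hasNormalForm (by simpa using hasNormalForm_of_nat 2)

/-- The configuration that remains when no mutation decreases the ranks, up to rotation: after sign
changes the ranks are `(x, x, y, y)`, and then `x / y` is `1`, `2` or `1 / 2`. -/
theorem IsRankVector.hasNormalForm_of_sq_eq (h : IsRankVector a b c d e f r s t u) (hr : r ≠ 0)
    (ht : t ≠ 0) (hrs : r ^ 2 = s ^ 2) (htu : t ^ 2 = u ^ 2)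
    (h0 : r ^ 2 + s ^ 2 - a * r * s = 0) : HasNormalForm (of a b c d e f) := by
  obtain ⟨p, hp⟩ := exists_sign r
  obtain ⟨q, hq⟩ := exists_sign s
  obtain ⟨v, hv⟩ := exists_sign t
  obtain ⟨w, hw⟩ := exists_sign u
  refine (MutationEquiv.sign_of p q v w a b c d e f).hasNormalForm ?_
  have h' := h.sign_of p q v w
  have hp2 : (p : ℤ) ^ 2 = 1 := by
    rw [← Units.val_pow_eq_pow_val, Int.units_sq, Units.val_one]
  have hq2 : (q : ℤ) ^ 2 = 1 := by
    rw [← Units.val_pow_eq_pow_val, Int.units_sq, Units.val_one]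
  have h0' : (p * r) ^ 2 + (q * s) ^ 2 - p * a * q * (p * r) * (q * s) = 0 := by grind
  rw [hp, hq, hv, hw, ← sq_eq_sq_iff_abs_eq_abs r s |>.1 hrs,
    ← sq_eq_sq_iff_abs_eq_abs t u |>.1 htu] at h'
  rw [hp, hq, ← sq_eq_sq_iff_abs_eq_abs r s |>.1 hrs] at h0'
  have hr' : 0 < |r| := abs_pos.2 hr
  have ht' : 0 < |t| := abs_pos.2 ht
  generalize |r| = x at *
  generalize |t| = y at *
  generalize (p : ℤ) * a * q = a' at *
  generalize (p : ℤ) * b * v = b' at *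
  generalize (p : ℤ) * c * w = c' at *
  generalize (q : ℤ) * d * v = d' at *
  generalize (q : ℤ) * e * w = e' at *
  generalize (v : ℤ) * f * w = f' at *
  obtain ⟨-, h1, h2, h3, h4, -, -, -, -, h5⟩ := h'
  have ha : a' = 2 := by
    have : x ^ 2 * (a' - 2) = 0 := by linear_combination -h0'
    have := (mul_eq_zero.1 this).resolve_left (pow_pos hr' 2).ne'
    linarith
  subst ha
  have hf : f' = 2 := by
    have : y ^ 2 * (f' - 2) = 0 := by linear_combination -h5
    have := (mul_eq_zero.1 this).resolve_left (pow_pos ht' 2).ne'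
    linarith
  subst hf
  -- with `b = d + k` and `e = d + l` the ratio of the ranks is `k / 2 = 2 / l`
  obtain ⟨k, rfl⟩ : ∃ k, b' = d' + k := ⟨b' - d', by ring⟩
  obtain ⟨l, rfl⟩ : ∃ l, e' = d' + l := ⟨e' - d', by ring⟩
  have hk : x * k = 2 * y := by linear_combination -h1
  have hl : y * l = 2 * x := by linear_combination -h4
  have hc : c' = d' + l + k := by
    have : x * (c' - (d' + l + k)) = 0 := by linear_combination -h2 - hk
    have := (mul_eq_zero.1 this).resolve_left hr'.ne'
    linarith
  subst hc
  have hkl : k * l = 4 := by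
    have : x * y * (k * l - 4) = 0 := by linear_combination (y * l) * hk + 2 * y * hl
    have := (mul_eq_zero.1 this).resolve_left (mul_pos hr' ht').ne'
    linarith
  have hk0 : 0 < k := by
    refine pos_of_mul_pos_right (a := x) ?_ hr'.le
    linarith
  have hl0 : 0 < l := by
    refine pos_of_mul_pos_right (a := y) ?_ ht'.le
    linarith
  have hk4 : k ≤ 4 := by nlinarith
  interval_cases k
  · obtain rfl : l = 4 := by linarith
    simpa [add_assoc] using hasNormalForm_one_four d'
  · obtain rfl : l = 2 := by linarith
    simpa [add_assoc] using hasNormalForm_two_two d'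
  · omega
  · obtain rfl : l = 1 := by linarith
    simpa [add_assoc] using hasNormalForm_four_one d'

/-- The combinatorial core of the descent: `R, S, T, U` are the squares of the ranks, and
`x, y, -x, -y` are the numbers `r² + s² - ars` of the four pairs of cyclic neighbours, each of which
lies outside the interval `(-|r² - s²|, r² + s²)` if no mutation of its pair decreases the ranks. -/
theorem eq_zero_of_no_decrease {R S T U x y : ℤ} (hR : 0 < R) (hS : 0 < S) (hT : 0 < T)
    (hU : 0 < U) (hxy : x * y = R * T - S * U)
    (h₁ : R + S ≤ x ∨ x ≤ R - S ∧ x ≤ S - R) (h₂ : S + T ≤ y ∨ y ≤ S - T ∧ y ≤ T - S)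
    (h₃ : T + U ≤ -x ∨ -x ≤ T - U ∧ -x ≤ U - T) (h₄ : U + R ≤ -y ∨ -y ≤ U - R ∧ -y ≤ R - U) :
    (x = 0 ∧ R = S ∧ T = U) ∨ (y = 0 ∧ S = T ∧ U = R) := by
  have hx : (x = 0 ∧ R = S ∧ T = U) ∨ R + S ≤ x ∨ T + U ≤ -x := by omega
  have hy : (y = 0 ∧ S = T ∧ U = R) ∨ S + T ≤ y ∨ U + R ≤ -y := by omega
  have hRT := mul_pos hR hT
  have hSU := mul_pos hS hU
  have hRS := mul_pos hR hS
  have hST := mul_pos hS hT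
  have hTU := mul_pos hT hU
  have hUR := mul_pos hU hR
  rcases hx with hx | hx | hx
  · exact Or.inl hx
  · rcases hy with hy | hy | hy
    · exact Or.inr hy
    · have := mul_le_mul hx hy (by linarith) (by linarith)
      nlinarith [sq_nonneg S]
    · have := mul_le_mul hx hy (by linarith) (by linarith)
      nlinarith [sq_nonneg R]
  · rcases hy with hy | hy | hy
    · exact Or.inr hy
    · have := mul_le_mul hx hy (by linarith) (by linarith)
      nlinarith [sq_nonneg T]
    · have := mul_le_mul hx hy (by linarith) (by linarith)
      nlinarith [sq_nonneg U]

/-- Unless a mutation of the first two vectors decreases the ranks, `r² + s² - ars` lies outside the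
interval `(-|r² - s²|, r² + s²)`. -/
theorem IsRankVector.hasNormalForm_or {k : ℤ}
    (ih : ∀ {a b c d e f r s t u : ℤ}, IsRankVector a b c d e f r s t u →
      0 < r ^ 2 + s ^ 2 + t ^ 2 + u ^ 2 → r ^ 2 + s ^ 2 + t ^ 2 + u ^ 2 < k →
        HasNormalForm (of a b c d e f))
    (h : IsRankVector a b c d e f r s t u) (hr : r ≠ 0) (hs : s ≠ 0)
    (hk : r ^ 2 + s ^ 2 + t ^ 2 + u ^ 2 ≤ k) :
    HasNormalForm (of a b c d e f) ∨ (r ^ 2 + s ^ 2 ≤ r ^ 2 + s ^ 2 - a * r * s ∨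
      r ^ 2 + s ^ 2 - a * r * s ≤ r ^ 2 - s ^ 2 ∧ r ^ 2 + s ^ 2 - a * r * s ≤ s ^ 2 - r ^ 2) := by
  have hr2 : 0 < r ^ 2 := by positivity
  have hs2 : 0 < s ^ 2 := by positivity
  by_cases h₁ : (r - a * s) ^ 2 < r ^ 2
  · refine Or.inl ((MutationEquiv.right_zero a b c d e f).hasNormalForm (ih h.right_zero ?_ ?_))
    · positivity
    · linarith
  by_cases h₂ : (s - a * r) ^ 2 < s ^ 2
  · refine Or.inl ((MutationEquiv.left_zero a b c d e f).hasNormalForm (ih h.left_zero ?_ ?_))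
    · positivity
    · linarith
  right
  by_contra! hcon
  obtain ⟨hpos, hlt⟩ := hcon
  rcases le_or_gt (r ^ 2 + s ^ 2 - a * r * s) (r ^ 2 - s ^ 2) with hc | hc
  · -- here `|r (r - as)| < r²`
    have hc' := hlt hc
    have : (r * (r - a * s)) ^ 2 < (r ^ 2) ^ 2 := sq_lt_sq.2 (by
      rw [abs_of_pos hr2, abs_lt]
      constructor <;> linarith)
    rw [mul_pow, pow_two (r ^ 2)] at this
    exact h₁ (lt_of_mul_lt_mul_left this hr2.le)
  · -- here `|s (s - ar)| < s²`
    have : (s * (s - a * r)) ^ 2 < (s ^ 2) ^ 2 := sq_lt_sq.2 (by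
      rw [abs_of_pos hs2, abs_lt]
      constructor <;> linarith)
    rw [mul_pow, pow_two (s ^ 2)] at this
    exact h₂ (lt_of_mul_lt_mul_left this hs2.le)

theorem IsRankVector.hasNormalForm_of_le (k : ℕ) : ∀ {a b c d e f r s t u : ℤ},
    IsRankVector a b c d e f r s t u → 0 < r ^ 2 + s ^ 2 + t ^ 2 + u ^ 2 →
      r ^ 2 + s ^ 2 + t ^ 2 + u ^ 2 ≤ k → HasNormalForm (of a b c d e f) := by
  induction k with
  | zero => intros; push_cast at *; omega
  | succ k ih =>
    intro a b c d e f r s t u h h0 hk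
    obtain ⟨v, hv⟩ : ∃ v, v = b - a * d := ⟨_, rfl⟩
    obtain ⟨w, hw⟩ : ∃ w, w = c - a * e - v * f := ⟨_, rfl⟩
    have rot := MutationEquiv.rotate a b c d e f v w hv hw
    have hrot := h.rotate hv hw
    have rot₂ := rot.trans (.rotate _ _ _ _ _ _ _ _ rfl rfl)
    have hrot₂ := hrot.rotate rfl rfl
    have rot₃ := rot₂.trans (.rotate _ _ _ _ _ _ _ _ rfl rfl)
    have hrot₃ := hrot₂.rotate rfl rfl
    rcases eq_or_ne r 0 with rfl | hr
    · exact h.hasNormalForm_of_zero (by linarith)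
    rcases eq_or_ne s 0 with rfl | hs
    · exact rot.hasNormalForm (hrot.hasNormalForm_of_zero (by linarith))
    rcases eq_or_ne t 0 with rfl | ht
    · exact rot₂.hasNormalForm (hrot₂.hasNormalForm_of_zero (by linarith))
    rcases eq_or_ne u 0 with rfl | hu
    · exact rot₃.hasNormalForm (hrot₃.hasNormalForm_of_zero (by linarith))
    have ih' : ∀ {a b c d e f r s t u : ℤ}, IsRankVector a b c d e f r s t u →
        0 < r ^ 2 + s ^ 2 + t ^ 2 + u ^ 2 → r ^ 2 + s ^ 2 + t ^ 2 + u ^ 2 < ((k + 1 : ℕ) : ℤ) →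
        HasNormalForm (of a b c d e f) := fun h h0 hlt => ih h h0 (by push_cast at hlt; linarith)
    rcases h.hasNormalForm_or ih' hr hs hk with hn | h₁
    · exact hn
    rcases hrot.hasNormalForm_or ih' hs ht (by linarith) with hn | h₂
    · exact rot.hasNormalForm hn
    rcases hrot₂.hasNormalForm_or ih' ht hu (by linarith) with hn | h₃
    · exact rot₂.hasNormalForm hn
    rcases hrot₃.hasNormalForm_or ih' hu hr (by linarith) with hn | h₄
    · exact rot₃.hasNormalForm hn
    have hpl := h.plucker
    have h13 : t ^ 2 + u ^ 2 - f * t * u = -(r ^ 2 + s ^ 2 - a * r * s) := by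
      linear_combination h.null
    rw [h13] at h₃
    have h24 : u ^ 2 + r ^ 2 - -w * u * r = -(s ^ 2 + t ^ 2 - d * s * t) := by
      linear_combination hrot.null
    rw [h24] at h₄
    rcases eq_zero_of_no_decrease (by positivity) (by positivity) (by positivity) (by positivity)
      hpl h₁ h₂ h₃ h₄ with ⟨h0, hrs, htu⟩ | ⟨h0, hst, hur⟩
    · exact h.hasNormalForm_of_sq_eq hr ht hrs htu h0
    · exact rot.hasNormalForm (hrot.hasNormalForm_of_sq_eq hs hu hst hur h0)

theorem IsRankVector.hasNormalForm (h : IsRankVector a b c d e f r s t u)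
    (h0 : 0 < r ^ 2 + s ^ 2 + t ^ 2 + u ^ 2) : HasNormalForm (of a b c d e f) :=
  IsRankVector.hasNormalForm_of_le _ h h0 (Int.self_le_toNat _)

theorem IsSolution.hasNormalForm (h : IsSolution a b c d e f)
    (hne : ¬(a = 0 ∧ b = 0 ∧ c = 0 ∧ d = 0 ∧ e = 0 ∧ f = 0)) :
    HasNormalForm (of a b c d e f) := by
  rcases eq_or_ne (d ^ 2 + e ^ 2 + f ^ 2 - d * e * f) 0 with h0 | h0
  · exact h.hasNormalForm_of_markov (by linarith) hne
  · exact (h.isRankVector rfl).hasNormalForm (by positivity)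

/-! ### Invariants of the orbits -/

open Matrix in
/-- Equivalent exceptional matrices are congruent over `ℤ`. -/
theorem MutationEquiv.exists_congr {M N : ExceptionalMatrix} (h : MutationEquiv M N) :
    ∃ G : Matrix (Fin 4) (Fin 4) ℤ, IsUnit G.det ∧ N.toMatrix = Gᵀ * M.toMatrix * G := by
  let S : Subgroup (Equiv.Perm ExceptionalMatrix) :=
    { carrier := {σ | ∀ M, ∃ G : Matrix (Fin 4) (Fin 4) ℤ, IsUnit G.det ∧
        (σ M).toMatrix = Gᵀ * M.toMatrix * G}
      one_mem' := fun M => ⟨1, by simp, by simp⟩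
      mul_mem' := fun {σ τ} hσ hτ M => by
        obtain ⟨G, hG, h⟩ := hτ M
        obtain ⟨H, hH, h'⟩ := hσ (τ M)
        refine ⟨G * H, by rw [det_mul]; exact hG.mul hH, ?_⟩
        rw [Equiv.Perm.mul_apply, h', h, transpose_mul]
        simp only [Matrix.mul_assoc]
      inv_mem' := fun {σ} hσ M => by
        obtain ⟨G, hG, h⟩ := hσ (σ⁻¹ M)
        refine ⟨G⁻¹, by rw [det_nonsing_inv]; exact hG.ringInverse, ?_⟩
        have hσM : σ (σ⁻¹ M) = M := Equiv.apply_symm_apply σ M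
        rw [hσM] at h
        have hGt : (G⁻¹)ᵀ * Gᵀ = 1 := by rw [← transpose_mul, mul_nonsing_inv G hG, transpose_one]
        rw [h, ← Matrix.mul_assoc, ← Matrix.mul_assoc, hGt, Matrix.one_mul, Matrix.mul_assoc,
          mul_nonsing_inv G hG, Matrix.mul_one] }
  have hmut : ∀ i, mutationPerm i ∈ S := by
    intro i M
    refine ⟨leftBase i M.toMatrix, ?_, rfl⟩
    -- the mutation matrix is a product of an elementary matrix and a transposition
    have : (leftBase i M.toMatrix).det = -1 := by
      fin_cases i <;> simp [leftBase, det_succ_row_zero, Fin.sum_univ_succ, Pi.single_apply,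
        Fin.succAbove]
    rw [this]
    exact isUnit_one.neg
  have hbraid : ∀ g, braidHom g ∈ S := by
    intro g
    have hle : Subgroup.closure (Set.range (PresentedGroup.of (rels := braidRels))) ≤
        S.comap braidHom := by
      rw [Subgroup.closure_le]
      rintro _ ⟨i, rfl⟩
      have hb : braidHom (PresentedGroup.of i) = mutationPerm i := PresentedGroup.toGroup.of _
      exact Subgroup.mem_comap.2 (hb ▸ hmut i)
    rw [PresentedGroup.closure_range_of] at hle
    exact hle (Subgroup.mem_top g)
  have hsign : ∀ ε, signPermHom ε ∈ S := by
    intro ε M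
    refine ⟨diagonal fun k => (ε k : ℤ), ?_, ?_⟩
    · rw [det_diagonal, ← Units.coe_prod]
      exact Units.isUnit _
    · ext k l
      rw [diagonal_transpose, mul_diagonal, diagonal_mul]
      rfl
  obtain ⟨g, rfl⟩ := h
  have hg : signedBraidHom g ∈ S := by
    rw [← SemidirectProduct.inl_left_mul_inr_right g, map_mul, signedBraidHom,
      SemidirectProduct.lift_inl, SemidirectProduct.lift_inr]
    exact S.mul_mem (hsign _) (hbraid _)
  exact hg M

open Matrix in
theorem dvd_congr {X : Matrix (Fin 4) (Fin 4) ℤ} {k : ℤ} (h : ∀ i j, k ∣ X i j)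
    (G : Matrix (Fin 4) (Fin 4) ℤ) (i j : Fin 4) : k ∣ (Gᵀ * X * G) i j := by
  simp only [mul_apply]
  exact Finset.dvd_sum fun l _ => Dvd.dvd.mul_right
    (Finset.dvd_sum fun m _ => Dvd.dvd.mul_left (h m l) _) _

open Matrix in
/-- Divisors of all the entries of the antisymmetric part `M - Mᵀ` are invariant. -/
theorem MutationEquiv.dvd_sub_transpose {M N : ExceptionalMatrix} (h : MutationEquiv M N) {k : ℤ}
    (hk : ∀ i j, k ∣ (M.toMatrix - M.toMatrixᵀ) i j) (i j : Fin 4) :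
    k ∣ (N.toMatrix - N.toMatrixᵀ) i j := by
  obtain ⟨G, -, hN⟩ := h.exists_congr
  have : N.toMatrix - N.toMatrixᵀ = Gᵀ * (M.toMatrix - M.toMatrixᵀ) * G := by
    simp only [hN, transpose_mul, transpose_transpose, Matrix.mul_sub, Matrix.sub_mul,
      Matrix.mul_assoc]
  exact this ▸ dvd_congr hk G i j

open Matrix in
/-- The form `(M - Mᵀ) M⁻¹ (M - Mᵀ)`, which for a solution of the equations has rank at most one and
content the absolute value of the degree `K²`. -/
noncomputable def degreeForm (M : ExceptionalMatrix) : Matrix (Fin 4) (Fin 4) ℤ :=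
  (M.toMatrix - M.toMatrixᵀ) * M.toMatrix⁻¹ * (M.toMatrix - M.toMatrixᵀ)

open Matrix in
/-- Divisors of all the entries of the degree form are invariant. -/
theorem MutationEquiv.dvd_degreeForm {M N : ExceptionalMatrix} (h : MutationEquiv M N) {k : ℤ}
    (hk : ∀ i j, k ∣ M.degreeForm i j) (i j : Fin 4) : k ∣ N.degreeForm i j := by
  obtain ⟨G, hG, hN⟩ := h.exists_congr
  have hGt : IsUnit Gᵀ.det := by rwa [det_transpose]
  have hA : N.toMatrix - N.toMatrixᵀ = Gᵀ * (M.toMatrix - M.toMatrixᵀ) * G := by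
    simp only [hN, transpose_mul, transpose_transpose, Matrix.mul_sub, Matrix.sub_mul,
      Matrix.mul_assoc]
  have : N.degreeForm = Gᵀ * M.degreeForm * G := by
    rw [degreeForm, hA, hN, Matrix.mul_inv_rev, Matrix.mul_inv_rev, degreeForm]
    simp only [Matrix.mul_assoc]
    rw [mul_nonsing_inv_cancel_left _ _ hG, nonsing_inv_mul_cancel_left _ _ hGt]
  exact this ▸ dvd_congr hk G i j

open Matrix in
theorem degreeForm_normalForm (n : ℤ) : (of n (2 * n) n 3 3 3).degreeForm =
    (9 - n ^ 2) • vecMulVec ![0, 1, 2, 1] ![0, 1, 2, 1] := by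
  have hinv : (of n (2 * n) n 3 3 3).toMatrix⁻¹ =
      !![1, -n, n, -n; 0, 1, -3, 6; 0, 0, 1, -3; 0, 0, 0, 1] := by
    refine inv_eq_right_inv ?_
    ext i j
    fin_cases i <;> fin_cases j <;> simp [of, Matrix.mul_apply, Fin.sum_univ_four] <;> ring
  rw [degreeForm, hinv]
  ext i j
  fin_cases i <;> fin_cases j <;>
    simp [of, Matrix.mul_apply, Fin.sum_univ_four] <;> ring

theorem dvd_of_mutationEquiv {m n : ℤ}
    (h : MutationEquiv (of m (2 * m) m 3 3 3) (of n (2 * n) n 3 3 3)) :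
    9 - m ^ 2 ∣ 9 - n ^ 2 := by
  have := h.dvd_degreeForm (k := 9 - m ^ 2) (fun i j => by
    rw [degreeForm_normalForm, Matrix.smul_apply, smul_eq_mul]
    exact dvd_mul_right _ _) 1 1
  rw [degreeForm_normalForm] at this
  simpa [Matrix.vecMulVec_apply] using this

theorem eq_of_mutationEquiv {m n : ℕ}
    (h : MutationEquiv (of m (2 * m) m 3 3 3) (of n (2 * n) n 3 3 3)) : m = n := by
  rcases Int.natAbs_eq_natAbs_iff.1 (Int.natAbs_eq_of_dvd_dvd (dvd_of_mutationEquiv h)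
    (dvd_of_mutationEquiv h.symm)) with h' | h'
  · have : (m : ℤ) ^ 2 = n ^ 2 := by linarith
    exact_mod_cast (sq_eq_sq₀ (by positivity) (by positivity)).1 this
  · -- `m² + n² = 18` has the only solution `m = n = 3`
    have h18 : m ^ 2 + n ^ 2 = 18 := by
      have : (m : ℤ) ^ 2 + n ^ 2 = 18 := by linarith
      exact_mod_cast this
    have hm : m ≤ 4 := by nlinarith
    have hn : n ≤ 4 := by nlinarith
    interval_cases m <;> interval_cases n <;> omega

/-- The form of `ℙ¹ × ℙ¹` is symmetric modulo `2`, the forms of the family are not. -/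
theorem not_mutationEquiv (n : ℤ) :
    ¬MutationEquiv (of 2 2 4 0 2 2) (of n (2 * n) n 3 3 3) := by
  intro h
  have := h.dvd_sub_transpose (k := 2) (fun i j => by
    fin_cases i <;> fin_cases j <;> simp [of]) 1 2
  simp [of] at this

theorem eq_of_mem_normalForms {M N : ExceptionalMatrix} (hM : M ∈ normalForms)
    (hN : N ∈ normalForms) (h : MutationEquiv M N) : M = N := by
  rcases hM with rfl | ⟨m, rfl⟩ <;> rcases hN with rfl | ⟨n, rfl⟩
  · rfl
  · exact absurd h (not_mutationEquiv n)
  · exact absurd h.symm (not_mutationEquiv m)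
  · rw [eq_of_mutationEquiv h]

end ExceptionalMatrix

theorem mainTheorem1 (a b c d e f : ℤ)
    (h₁ : a * c * d * f - a * b * d - a * c * e - b * c * f - d * e * f
      + a ^ 2 + b ^ 2 + c ^ 2 + d ^ 2 + e ^ 2 + f ^ 2 = 0)
    (h₂ : a * f - b * e + c * d = 0)
    (hne : !![1, a, b, c; 0, 1, d, e; 0, 0, 1, f; 0, 0, 0, 1] ≠ (1 : Matrix (Fin 4) (Fin 4) ℤ)) :
    ∃! N : ExceptionalMatrix, N ∈ ExceptionalMatrix.normalForms ∧
      ∃ g : SignedBraidGroup4, g • ExceptionalMatrix.of a b c d e f = N := by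
  obtain ⟨N, hN, h⟩ : ExceptionalMatrix.HasNormalForm (.of a b c d e f) := by
    refine ExceptionalMatrix.IsSolution.hasNormalForm ⟨h₁, h₂⟩ ?_
    rintro ⟨rfl, rfl, rfl, rfl, rfl, rfl⟩
    refine hne ?_
    ext i j
    fin_cases i <;> fin_cases j <;> rfl
  refine ⟨N, ⟨hN, h⟩, ?_⟩
  rintro N' ⟨hN', h'⟩
  exact ExceptionalMatrix.eq_of_mem_normalForms hN' hN
    ((ExceptionalMatrix.MutationEquiv.symm h').trans h)
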